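/- Let $R$ be a finite set of registers. A test over $R$ is a maximally consistent set of atoms $*=r$, $*<r$, $*>r$ with $r\in R$ (so exactly one atom for each $r$); for every valuation $v\in\mathbb N^R$ and every $d\in\mathbb N$ there is exactly one test that holds when $*$ is replaced by $d$ and each $r$ by $v(r)$. A deterministic register automaton is a tuple $S=(Q,q_0,R,\delta,\alpha)$ with a finite set of states $Q=Q_A\uplus Q_E$, an initial state $q_0\in Q_A$, a finite set $R$ of registers, a total transition function $\delta$ that maps $Q_A\times\mathrm{Tst}_R$ to $2^R\times Q_E$ and $Q_E\times\mathrm{Tst}_R$ to $2^R\times Q_A$, and a priority function $\alpha:Q\to\{1,\dots,c\}$. The run of $S$ on $d_0d_1\dots\in\mathbb N^\omega$ is the sequence $(q_0,v_0)(q_1,v_1)\dots$ with $v_0=0^R$ and, for each $i$, $\delta(q_i,t_i)=(\mathrm{asgn}_i,q_{i+1})$, where $t_i$ is the test satisfied by $(v_i,d_i)$, $v_{i+1}(r)=d_i$ for $r\in\mathrm{asgn}_i$ and $v_{i+1}(r)=v_i(r)$ for $r\notin\mathrm{asgn}_i$. The word is accepted if the maximal priority that occurs infinitely often in $\alpha(q_0)\alpha(q_1)\dots$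 is even. In the (two-sided) Church game over $(\mathbb N,\le)$ with specification $S$, Adam uses a strategy $\lambda_A:\mathbb N^*\to\mathbb N$ and Eve a strategy $\lambda_E:\mathbb N^+\to\mathbb N$. Their outcome is the word $i_0o_0i_1o_1\dots$ with $i_j=\lambda_A(o_0\dots o_{j-1})$ and $o_j=\lambda_E(i_0\dots i_j)$ for all $j\ge 0$. Eve wins the game if she has a strategy $\lambda_E$ such that for every Adam strategy $\lambda_A$ the outcome is accepted by $S$. **Theorem.** The following problem is undecidable: given a deterministic register automaton $S$ (described by explicit finite tables), does Eve win the Church game over $(\mathbb N,\le)$ with specification $S$? That is, there is no algorithm that answers this question correctly for every deterministic register automaton $S$. -/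

import Mathlib

/-! ## Church synthesis games -/

/-- A Church synthesis game with input alphabet `I` and output alphabet `O`. A word of
`(I · O)^ω` is written as its sequence of rounds: `w j = (i_j, o_j)`. -/
structure ChurchGame (I O : Type) where
  /-- The specification. -/
  spec : Set (ℕ → I × O)

namespace ChurchGame

variable {I O : Type}

/-- Adam's strategies `O^* → I`. -/
abbrev AdamStrategy (I O : Type) := List O → I

/-- Eve's strategies `I^+ → O`. Words are in chronological order;
the value at the empty word is never used. -/
abbrev EveStrategy (I O : Type) := List I → O

/-- The inputs and the outputs chosen during the first `j` rounds, in chronological order. -/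
def history (lamA : AdamStrategy I O) (lamE : EveStrategy I O) : ℕ → List I × List O
  | 0 => ([], [])
  | j + 1 =>
    let h := history lamA lamE j
    let is := h.1 ++ [lamA h.2]
    (is, h.2 ++ [lamE is])

/-- The outcome of two strategies, round by round:
`i_j = lamA (o_0 ... o_{j-1})` and `o_j = lamE (i_0 ... i_j)`. -/
def outcome (lamA : AdamStrategy I O) (lamE : EveStrategy I O) (j : ℕ) : I × O :=
  let h := history lamA lamE j
  (lamA h.2, lamE (h.1 ++ [lamA h.2]))

theorem history_eq (lamA : AdamStrategy I O) (lamE : EveStrategy I O) (j : ℕ) :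
    history lamA lamE j =
      ((List.range j).map (fun t => (outcome lamA lamE t).1),
        (List.range j).map (fun t => (outcome lamA lamE t).2)) := by
  induction j with
  | zero => rfl
  | succ j ih =>
    have h : history lamA lamE (j + 1) =
        ((history lamA lamE j).1 ++ [(outcome lamA lamE j).1],
          (history lamA lamE j).2 ++ [(outcome lamA lamE j).2]) := rfl
    rw [h, ih]
    simp [List.range_succ]

/-- The defining equations of the outcome. -/
theorem outcome_spec (lamA : AdamStrategy I O) (lamE : EveStrategy I O) (j : ℕ) :
    (outcome lamA lamE j).1 =
        lamA ((List.range j).map (fun t => (outcome lamA lamE t).2)) ∧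
      (outcome lamA lamE j).2 =
        lamE ((List.range (j + 1)).map (fun t => (outcome lamA lamE t).1)) := by
  have h1 : (outcome lamA lamE j).1 = lamA (history lamA lamE j).2 := rfl
  have h2 : (outcome lamA lamE j).2 = lamE (history lamA lamE (j + 1)).1 := rfl
  refine ⟨?_, ?_⟩
  · rw [h1, history_eq]
  · rw [h2, history_eq]

/-- Eve has a strategy that wins against every strategy of Adam. -/
def EveWins (G : ChurchGame I O) : Prop :=
  ∃ lamE : EveStrategy I O, ∀ lamA : AdamStrategy I O, outcome lamA lamE ∈ G.spec

end ChurchGame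

/-! ## Deterministic register automata -/

/-- A test over the registers `R`. A maximally consistent set of atoms `* = r`, `* < r`, `* > r`
contains exactly one of the three for each `r`, and every such choice is consistent. The value
at `r` is `.lt` for `* < r`, `.eq` for `* = r` and `.gt` for `* > r`. -/
abbrev RegTest (R : Type) := R → Ordering

/-- The unique test satisfied by the valuation `v` and the data `d`. -/
def testOf {R D : Type} [LinearOrder D] (v : R → D) (d : D) : RegTest R :=
  fun r => cmp d (v r)

/-- Store `d` in the registers of `asgn`, keep the others. -/
def updateRegs {R D : Type} [DecidableEq R] (v : R → D) (d : D) (asgn : Finset R) : R → D :=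
  fun r => if r ∈ asgn then d else v r

/-- A deterministic register automaton with Adam states `QA`, Eve states `QE` and registers `R`. -/
@[ext]
structure DetRegAut (QA QE R : Type) where
  /-- The initial state. -/
  q0 : QA
  /-- Transitions from Adam states. -/
  deltaA : QA → RegTest R → Finset R × QE
  /-- Transitions from Eve states. -/
  deltaE : QE → RegTest R → Finset R × QA
  /-- The priority index. -/
  index : ℕ
  /-- The priority function. -/
  prio : QA ⊕ QE → ℕ
  prio_mem : ∀ q, 1 ≤ prio q ∧ prio q ≤ index

namespace DetRegAut

variable {QA QE R : Type} (S : DetRegAut QA QE R)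

/-- The transition function on all states. -/
def delta : QA ⊕ QE → RegTest R → Finset R × (QA ⊕ QE)
  | .inl q, t => ((S.deltaA q t).1, .inr (S.deltaA q t).2)
  | .inr q, t => ((S.deltaE q t).1, .inl (S.deltaE q t).2)

variable {D : Type} [LinearOrder D] [Zero D] [DecidableEq R]

/-- The configuration reached from a configuration by reading `d`. -/
def step (c : (QA ⊕ QE) × (R → D)) (d : D) : (QA ⊕ QE) × (R → D) :=
  let m := S.delta c.1 (testOf c.2 d)
  (m.2, updateRegs c.2 d m.1)

/-- The run on the data word `w`; initially every register holds `0`. -/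
def run (w : ℕ → D) : ℕ → (QA ⊕ QE) × (R → D)
  | 0 => (.inl S.q0, fun _ => 0)
  | n + 1 => S.step (run w n) (w n)

/-- The maximal priority visited infinitely often is even. -/
def Accepts (w : ℕ → D) : Prop :=
  ∃ p : ℕ, IsGreatest {p | ∃ᶠ n in Filter.atTop, S.prio (S.run w n).1 = p} p ∧ Even p

/-- The language of the automaton over the data domain `D`. -/
def language (D : Type) [LinearOrder D] [Zero D] : Set (ℕ → D) :=
  {w | S.Accepts w}

end DetRegAut

/-- The data word `i_0 o_0 i_1 o_1 ...` of a sequence of rounds. -/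
def interleave {D : Type} (w : ℕ → D × D) (n : ℕ) : D :=
  if n % 2 = 0 then (w (n / 2)).1 else (w (n / 2)).2

/-- The two-sided Church game over the data domain `D` whose specification is `S`: both players
pick data. -/
def DetRegAut.churchGame {QA QE R : Type} [DecidableEq R] (S : DetRegAut QA QE R)
    (D : Type) [LinearOrder D] [Zero D] : ChurchGame D D where
  spec := {w | interleave w ∈ S.language D}

/-! ## Finite automata as inputs of algorithms -/

/-- A deterministic register automaton with finitely many states and registers, which are numbered
from `0`. -/
structure FinRegAut where
  /-- The number of Adam states. -/
  numA : ℕ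
  /-- The number of Eve states. -/
  numE : ℕ
  /-- The number of registers. -/
  numR : ℕ
  /-- The automaton. -/
  aut : DetRegAut (Fin numA) (Fin numE) (Fin numR)

/-- The `i`-th test over `k` registers: the base-three digits of `i`, least significant first, with
`0`, `1`, `2` standing for `.lt`, `.eq`, `.gt`. -/
def testOfIndex (k : ℕ) (i : Fin (3 ^ k)) : RegTest (Fin k) :=
  fun r => (![Ordering.lt, Ordering.eq, Ordering.gt] : Fin 3 → Ordering)
    (finFunctionFinEquiv.symm i r)

/-- A transition table: for each state, the list over all tests of the pairs
(characteristic list of the assignment, number of the successor state). -/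
abbrev TableCode := List (List (List Bool × ℕ))

/-- Codes of automata: (numbers of Adam states, of Eve states and of registers, initial state,
priority index), transition tables of Adam and Eve states, priorities of Adam and Eve states. -/
abbrev RegAutCode := (ℕ × ℕ × ℕ × ℕ × ℕ) × (TableCode × TableCode) × (List ℕ × List ℕ)

/-- The table of a transition function. -/
def encodeTable {m n k : ℕ} (f : Fin m → RegTest (Fin k) → Finset (Fin k) × Fin n) : TableCode :=
  List.ofFn fun q : Fin m => List.ofFn fun i : Fin (3 ^ k) =>
    let t := f q (testOfIndex k i)
    (List.ofFn (fun r : Fin k => decide (r ∈ t.1)), (t.2 : ℕ))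

/-- The code of an automaton: its explicit description by tables. -/
def FinRegAut.encode (S : FinRegAut) : RegAutCode :=
  ((S.numA, S.numE, S.numR, (S.aut.q0 : ℕ), S.aut.index),
    (encodeTable S.aut.deltaA, encodeTable S.aut.deltaE),
    (List.ofFn (fun q => S.aut.prio (.inl q)), List.ofFn (fun q => S.aut.prio (.inr q))))

theorem testOfIndex_surjective (k : ℕ) : Function.Surjective (testOfIndex k) := by
  intro t
  have h : ∀ o : Ordering, ∃ j : Fin 3,
      (![Ordering.lt, Ordering.eq, Ordering.gt] : Fin 3 → Ordering) j = o := by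
    intro o
    cases o
    · exact ⟨0, rfl⟩
    · exact ⟨1, rfl⟩
    · exact ⟨2, rfl⟩
  choose g hg using h
  refine ⟨finFunctionFinEquiv (fun r => g (t r)), ?_⟩
  funext r
  simp only [testOfIndex, Equiv.symm_apply_apply, hg]

theorem encodeTable_injective {m n k : ℕ} :
    Function.Injective (encodeTable (m := m) (n := n) (k := k)) := by
  intro f g h
  funext q t
  obtain ⟨i, rfl⟩ := testOfIndex_surjective k t
  have h1 := congrFun (List.ofFn_injective (congrFun (List.ofFn_injective h) q)) i
  simp only [Prod.mk.injEq] at h1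
  refine Prod.ext ?_ (Fin.ext h1.2)
  ext r
  have h2 := congrFun (List.ofFn_injective h1.1) r
  simpa using h2

/-- The code determines the automaton. -/
theorem FinRegAut.encode_injective : Function.Injective FinRegAut.encode := by
  rintro ⟨a, e, k, S⟩ ⟨a', e', k', T⟩ h
  simp only [FinRegAut.encode, Prod.mk.injEq] at h
  obtain ⟨⟨rfl, rfl, rfl, h0, hi⟩, ⟨hA, hE⟩, hp, hq⟩ := h
  congr 1
  refine DetRegAut.ext (Fin.ext h0) (encodeTable_injective hA) (encodeTable_injective hE) hi ?_
  funext q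
  cases q with
  | inl q => exact congrFun (List.ofFn_injective hp) q
  | inr q => exact congrFun (List.ofFn_injective hq) q

/-! ## Reachability games on valuations -/

/-! The game simulates a fixed alternating program on finitely many registers: Eve and Adam choose
contents and branches, registers are compared or incremented, and Eve must reach a winning leaf
after finitely many steps. Her winning region `Wins` is the least fixed point of the one-step
semantics. The predicates obtained this way are closed under conjunction, disjunction and both
quantifiers and, because a program may call itself, under least fixed points (`Definable.lfp`).
Successor and order then yield pairing, primitive recursion and minimisation, so every partial
recursive graph is definable (`Definable.of_partrec`), and with it a halting problem.

A register automaton can only compare data, so increments are enforced by the players. Adam proposes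
some `d` above the content of `r`; Eve either repeats `d`, which is then stored in `r`, or wins by
naming a number strictly between the old content and `d`. By discreteness of ℕ, the successor is the
only proposal that does not lose for Adam at once, and against it Eve must repeat. Hence one round
of the game is one step of the program (`sem_of_round`, `round_of_sem`), and Eve wins the game
exactly from `Wins` (`eveWins_iff`).

All registers start at `0`, so the input is loaded by a chain of increments hard-wired into the
states. Only the number of states and the initial state depend on the input, and the tables are
primitive recursive in it; deciding the games would decide halting. -/

/-- Instructions of alternating programs with successor states in `Q`, working on registers that
are numbered by `ℕ` and hold natural numbers. -/
inductive GameInstr (Q : Type) where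
  /-- A call of the predicate parameter. -/
  | hole
  /-- Eve wins if the first register is smaller than the second. -/
  | lt (a b : ℕ)
  /-- Eve wins if the first register is at most the second. -/
  | le (a b : ℕ)
  /-- Eve chooses the content of a register. -/
  | ex (r : ℕ) (q : Q)
  /-- Adam chooses the content of a register. -/
  | all (r : ℕ) (q : Q)
  /-- Adam chooses the successor. -/
  | and (p q : Q)
  /-- Eve chooses the successor. -/
  | or (p q : Q)
  /-- Increment a register. -/
  | inc (r : ℕ) (q : Q)

namespace GameInstr

variable {P Q : Type}

/-- Rename the successor states. -/
def map (e : P → Q) : GameInstr P → GameInstr Q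
  | hole => hole
  | lt a b => lt a b
  | le a b => le a b
  | ex r q => ex r (e q)
  | all r q => all r (e q)
  | and p q => and (e p) (e q)
  | or p q => or (e p) (e q)
  | inc r q => inc r (e q)

/-- Replace the parameter by a jump to a state. -/
def plug (q₀ : Q) : GameInstr Q → GameInstr Q
  | hole => or q₀ q₀
  | I => I

/-- The condition for Eve to win at an instruction, where `X` is the parameter and `Y` tells where
she wins at the successors. -/
def Sem (X : (ℕ → ℕ) → Prop) (Y : Q → (ℕ → ℕ) → Prop) : GameInstr Q → (ℕ → ℕ) → Prop
  | hole, v => X v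
  | lt a b, v => v a < v b
  | le a b, v => v a ≤ v b
  | ex r q, v => ∃ d, Y q (Function.update v r d)
  | all r q, v => ∀ d, Y q (Function.update v r d)
  | and p q, v => Y p v ∧ Y q v
  | or p q, v => Y p v ∨ Y q v
  | inc r q, v => Y q (Function.update v r (v r + 1))

theorem Sem.mono {X X' : (ℕ → ℕ) → Prop} {Y Y' : Q → (ℕ → ℕ) → Prop} (hX : ∀ v, X v → X' v)
    (hY : ∀ q v, Y q v → Y' q v) {I : GameInstr Q} {v : ℕ → ℕ} (h : I.Sem X Y v) :
    I.Sem X' Y' v := by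
  cases I with
  | hole => exact hX _ h
  | lt a b => exact h
  | le a b => exact h
  | ex r q => exact h.imp fun d => hY _ _
  | all r q => exact fun d => hY _ _ (h d)
  | and p q => exact h.imp (hY _ _) (hY _ _)
  | or p q => exact h.imp (hY _ _) (hY _ _)
  | inc r q => exact hY _ _ h

theorem sem_map (e : P → Q) (X : (ℕ → ℕ) → Prop) (Y : Q → (ℕ → ℕ) → Prop) (I : GameInstr P)
    (v : ℕ → ℕ) : (I.map e).Sem X Y v ↔ I.Sem X (fun p => Y (e p)) v := by
  cases I <;> rfl

theorem sem_plug (q₀ : Q) (X : (ℕ → ℕ) → Prop) (Y : Q → (ℕ → ℕ) → Prop) (I : GameInstr Q)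
    (v : ℕ → ℕ) : (I.plug q₀).Sem X Y v ↔ I.Sem (Y q₀) Y v := by
  cases I <;> simp [plug, Sem]

/-- A strict bound on the registers of an instruction. -/
def bound : GameInstr Q → ℕ
  | lt a b => max a b + 1
  | le a b => max a b + 1
  | ex r _ => r + 1
  | all r _ => r + 1
  | inc r _ => r + 1
  | _ => 0

theorem bound_map (e : P → Q) (I : GameInstr P) : (I.map e).bound = I.bound := by
  cases I <;> rfl

/-- The positions from which Eve wins the program `T`: the least fixed point of `Sem`. -/
def Wins (T : Q → GameInstr Q) (X : (ℕ → ℕ) → Prop) (q : Q) (v : ℕ → ℕ) : Prop :=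
  ∀ Y : Q → (ℕ → ℕ) → Prop, (∀ q v, (T q).Sem X Y v → Y q v) → Y q v

theorem Wins.induction {T : Q → GameInstr Q} {X : (ℕ → ℕ) → Prop} {Y : Q → (ℕ → ℕ) → Prop}
    (hY : ∀ q v, (T q).Sem X Y v → Y q v) {q : Q} {v : ℕ → ℕ} (h : Wins T X q v) : Y q v :=
  h Y hY

theorem wins_of_sem {T : Q → GameInstr Q} {X : (ℕ → ℕ) → Prop} {q : Q} {v : ℕ → ℕ}
    (h : (T q).Sem X (Wins T X) v) : Wins T X q v := fun _ hY =>
  hY q v (h.mono (fun _ => id) fun _ _ => Wins.induction hY)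

/-- Knaster–Tarski: the one-step image of `Wins` is itself closed under steps, so it contains the
least fixed point. -/
theorem wins_iff {T : Q → GameInstr Q} {X : (ℕ → ℕ) → Prop} {q : Q} {v : ℕ → ℕ} :
    Wins T X q v ↔ (T q).Sem X (Wins T X) v :=
  ⟨Wins.induction (Y := fun q => (T q).Sem X (Wins T X)) fun _ _ h =>
    h.mono (fun _ => id) fun _ _ => wins_of_sem, wins_of_sem⟩

/-- Winning in a program is preserved by embeddings into larger programs. -/
theorem wins_embed {T : P → GameInstr P} {T' : Q → GameInstr Q} {e : P → Q}
    (he : ∀ p, T' (e p) = (T p).map e) (X : (ℕ → ℕ) → Prop) (p : P) (v : ℕ → ℕ) :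
    Wins T' X (e p) v ↔ Wins T X p v := by
  constructor
  · intro h
    refine h.induction (Y := fun q v => ∀ p, e p = q → Wins T X p v) ?_ p rfl
    rintro _ v h p rfl
    rw [he, sem_map] at h
    exact wins_of_sem (h.mono (fun _ => id) fun p _ h => h p rfl)
  · refine Wins.induction (Y := fun p => Wins T' X (e p)) fun p v h => wins_of_sem ?_
    rwa [he, sem_map]

/-- Closing the parameter by the program itself gives a least fixed point. -/
theorem wins_plug (T : Q → GameInstr Q) (X : (ℕ → ℕ) → Prop) (q₀ : Q) (v : ℕ → ℕ) :
    Wins (fun q => (T q).plug q₀) X q₀ v ↔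
      ∀ Z : (ℕ → ℕ) → Prop, (∀ u, Wins T Z q₀ u → Z u) → Z v := by
  constructor
  · intro h Z hZ
    -- Calls are harmless here: a call lands in `Wins T Z q₀`, which is contained in `Z`, the value
    -- of the parameter in `T`.
    refine hZ v (h.induction (Y := Wins T Z) fun q u hq => wins_of_sem ?_)
    rw [sem_plug] at hq
    exact hq.mono hZ fun _ _ => id
  · intro h
    refine h _ fun u hu => hu.induction (Y := Wins (fun q => (T q).plug q₀) X)
      fun q u hq => wins_of_sem ?_
    rwa [sem_plug]

/-- The union of two programs. -/
def sumProg (S : P → GameInstr P) (T : Q → GameInstr Q) : P ⊕ Q → GameInstr (P ⊕ Q) :=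
  Sum.elim (fun p => (S p).map Sum.inl) (fun q => (T q).map Sum.inr)

/-- A program extended by a state. -/
def rootProg (I : GameInstr (Option Q)) (T : Q → GameInstr Q) : Option Q → GameInstr (Option Q)
  | none => I
  | some q => (T q).map some

end GameInstr

/-! ## Operators defined by finite programs -/

open GameInstr in
/-- The operators on predicates that finite programs define. -/
def Definable (Φ : ((ℕ → ℕ) → Prop) → (ℕ → ℕ) → Prop) : Prop :=
  ∃ (Q : Type) (_ : Finite Q) (T : Q → GameInstr Q) (q : Q), ∀ X v, Wins T X q v ↔ Φ X v

namespace Definable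

open GameInstr Function

variable {Φ Ψ : ((ℕ → ℕ) → Prop) → (ℕ → ℕ) → Prop}

theorem congr (h : Definable Φ) (hΨ : ∀ X v, Ψ X v ↔ Φ X v) : Definable Ψ := by
  obtain ⟨Q, _, T, q, hT⟩ := h
  exact ⟨Q, ‹_›, T, q, fun X v => (hT X v).trans (hΨ X v).symm⟩

theorem leaf (I : GameInstr Unit) : Definable fun X v => I.Sem X (Wins (fun _ => I) X) v :=
  ⟨Unit, inferInstance, fun _ => I, (), fun _ _ => wins_iff⟩

theorem hole : Definable fun X v => X v := leaf .hole

theorem lt (a b : ℕ) : Definable fun _ v => v a < v b := leaf (.lt a b)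

theorem le (a b : ℕ) : Definable fun _ v => v a ≤ v b := leaf (.le a b)

/-- `hI` says that `I` depends only on the predicate at its one successor, uniformly in the state
type, which lets its meaning be stated over `Unit`. -/
theorem root₁ (h : Definable Φ) (I : ∀ {Q : Type}, Q → GameInstr Q)
    (hI : ∀ {Q : Type} (q : Q) (X : (ℕ → ℕ) → Prop) (Y : Q → (ℕ → ℕ) → Prop) (v : ℕ → ℕ),
      (I q).Sem X Y v ↔ (I ()).Sem X (fun _ => Y q) v) :
    Definable fun X v => (I ()).Sem X (fun _ => Φ X) v := by
  obtain ⟨Q, _, T, q, hT⟩ := h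
  refine ⟨Option Q, inferInstance, rootProg (I (some q)) T, none, fun X v => ?_⟩
  have : Wins (rootProg (I (some q)) T) X (some q) = Φ X := by
    funext u
    rw [wins_embed (T := T) (e := some) (fun p => rfl)]
    exact propext (hT X u)
  rw [wins_iff, rootProg, hI, this]

theorem root₂ (h : Definable Φ) (h' : Definable Ψ) (I : ∀ {Q : Type}, Q → Q → GameInstr Q)
    (hI : ∀ {Q : Type} (p q : Q) (X : (ℕ → ℕ) → Prop) (Y : Q → (ℕ → ℕ) → Prop) (v : ℕ → ℕ),
      (I p q).Sem X Y v ↔ (I true false).Sem X (fun b => bif b then Y p else Y q) v) :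
    Definable fun X v => (I true false).Sem X (fun b => bif b then Φ X else Ψ X) v := by
  obtain ⟨P, _, S, p, hS⟩ := h
  obtain ⟨Q, _, T, q, hT⟩ := h'
  set U := rootProg (I (some (.inl p)) (some (.inr q))) (sumProg S T) with hU
  refine ⟨Option (P ⊕ Q), inferInstance, U, none, fun X v => ?_⟩
  have h1 : Wins U X (some (.inl p)) = Φ X := by
    funext u
    rw [wins_embed (T := sumProg S T) (e := some) (fun p => rfl),
      wins_embed (T := S) (e := Sum.inl) (fun p => rfl)]
    exact propext (hS X u)
  have h2 : Wins U X (some (.inr q)) = Ψ X := by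
    funext u
    rw [wins_embed (T := sumProg S T) (e := some) (fun p => rfl),
      wins_embed (T := T) (e := Sum.inr) (fun p => rfl)]
    exact propext (hT X u)
  rw [wins_iff, hU, rootProg, ← hU, hI, h1, h2]

theorem and (h : Definable Φ) (h' : Definable Ψ) : Definable fun X v => Φ X v ∧ Ψ X v :=
  root₂ h h' .and fun _ _ _ _ _ => Iff.rfl

theorem or (h : Definable Φ) (h' : Definable Ψ) : Definable fun X v => Φ X v ∨ Ψ X v :=
  root₂ h h' .or fun _ _ _ _ _ => Iff.rfl

theorem ex (r : ℕ) (h : Definable Φ) : Definable fun X v => ∃ d, Φ X (update v r d) :=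
  root₁ h (.ex r) fun _ _ _ _ => Iff.rfl

theorem all (r : ℕ) (h : Definable Φ) : Definable fun X v => ∀ d, Φ X (update v r d) :=
  root₁ h (.all r) fun _ _ _ _ => Iff.rfl

theorem inc (r : ℕ) (h : Definable Φ) : Definable fun X v => Φ X (update v r (v r + 1)) :=
  root₁ h (.inc r) fun _ _ _ _ => Iff.rfl

/-- Least fixed points of definable operators are definable. -/
theorem lfp (h : Definable Φ) {P : (ℕ → ℕ) → Prop} (h₁ : ∀ v, Φ P v → P v)
    (h₂ : ∀ Z : (ℕ → ℕ) → Prop, (∀ v, Φ Z v → Z v) → ∀ v, P v → Z v) :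
    Definable fun _ v => P v := by
  obtain ⟨Q, _, T, q, hT⟩ := h
  refine ⟨Q, ‹_›, fun p => (T p).plug q, q, fun X v => ?_⟩
  rw [wins_plug]
  simp only [hT]
  exact ⟨fun h => h P h₁, fun h Z hZ => h₂ Z hZ v h⟩

theorem eq (a b : ℕ) : Definable fun _ v => v a = v b :=
  ((le a b).and (le b a)).congr fun _ _ => le_antisymm_iff

/-- Copy the register `a` to the register `b`. -/
theorem copy {a b : ℕ} (hab : a ≠ b) (h : Definable Φ) :
    Definable fun X v => Φ X (update v b (v a)) :=
  (((eq a b).and h).ex b).congr fun _ _ => by simp [hab]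

/-- Zero is the least number: Adam may challenge with any content of the scratch register `a + 1`.
-/
theorem eq_zero (a : ℕ) : Definable fun _ v => v a = 0 :=
  ((le a (a + 1)).all (a + 1)).congr fun _ v =>
    ⟨fun h => by simp [h], fun h => by simpa using h 0⟩

/-- The increment acts on a copy. Here and below, a sum of the indices in use plus a positive
constant is an index of a fresh register. -/
theorem eq_succ (a b : ℕ) : Definable fun _ v => v b = v a + 1 :=
  (((eq b (a + b + 1)).inc (a + b + 1)).copy (a := a) (b := a + b + 1) (by omega)).congr
    fun _ v => by simp (disch := omega) [update_of_ne]

end Definable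

/-! ## Partial recursive functions are definable -/

/-- `(a', b')` immediately precedes `(a, b)` in the enumeration `Nat.unpair` of pairs. -/
def PairPrec (a b a' b' : ℕ) : Prop :=
  (a < b ∧ a = a' + 1 ∧ b = b') ∨ (b = 0 ∧ a = a' + 1 ∧ a = b') ∨
    (b ≤ a ∧ b = b' + 1 ∧ a = a') ∨ (a = 0 ∧ b = b' + 1 ∧ a' = b')

/-- `Nat.pair` enumerates square shells: shell `s` is `(0, s), …, (s - 1, s), (s, 0), …, (s, s)`.
The cases of `PairPrec` are the two sides of a shell, its turning point, and the passage from the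
previous shell. -/
theorem PairPrec.pair_eq {a b a' b' : ℕ} (h : PairPrec a b a' b') :
    Nat.pair a b = Nat.pair a' b' + 1 := by
  unfold Nat.pair
  rcases h with ⟨h, rfl, rfl⟩ | ⟨rfl, rfl, rfl⟩ | ⟨h, rfl, rfl⟩ | ⟨rfl, rfl, rfl⟩
  · rw [if_pos h, if_pos (by omega)]; ring
  · rw [if_neg (by omega), if_pos (by omega)]; ring
  · rw [if_neg (by omega), if_neg (by omega)]; ring
  · rw [if_pos (by omega), if_neg (by omega)]; ring

theorem exists_pairPrec {a b : ℕ} (h : Nat.pair a b ≠ 0) : ∃ a' b', PairPrec a b a' b' := by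
  have h0 : ¬ (a = 0 ∧ b = 0) := by
    rintro ⟨rfl, rfl⟩
    exact h rfl
  unfold PairPrec
  rcases Nat.eq_zero_or_pos a with ha | ha
  · exact ⟨b - 1, b - 1, by omega⟩
  · rcases Nat.eq_zero_or_pos b with hb | hb
    · exact ⟨a - 1, a, by omega⟩
    · rcases lt_or_ge a b with hab | hab
      · exact ⟨a - 1, b, by omega⟩
      · exact ⟨a, b - 1, by omega⟩

namespace Definable

open Function

theorem pairPrec (a b a' b' : ℕ) : Definable fun _ v => PairPrec (v a) (v b) (v a') (v b') :=
  ((lt a b).and ((eq_succ a' a).and (eq b b'))).or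
    (((eq_zero b).and ((eq_succ a' a).and (eq a b'))).or
      (((le b a).and ((eq_succ b' b).and (eq a a'))).or
        ((eq_zero a).and ((eq_succ b' b).and (eq a' b')))))

/-- Pairing by counting: walk back through the enumeration of pairs and decrease the code in
parallel until everything is `0`. The registers from `N + 3` on are scratch for the arguments of the
recursive call. -/
theorem eq_pair_aux (N : ℕ) :
    Definable fun _ v => v (N + 2) = Nat.pair (v N) (v (N + 1)) := by
  have h : Definable fun X v => (v N = 0 ∧ v (N + 1) = 0 ∧ v (N + 2) = 0) ∨
      ∃ a b c, v (N + 2) = c + 1 ∧ PairPrec (v N) (v (N + 1)) a b ∧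
        X (update (update (update (update (update (update v (N + 3) a) (N + 4) b) (N + 5) c)
          N a) (N + 1) b) (N + 2) c) := by
    refine (((eq_zero N).and ((eq_zero (N + 1)).and (eq_zero (N + 2)))).or
      (((((eq_succ (N + 5) (N + 2)).and ((pairPrec N (N + 1) (N + 3) (N + 4)).and
        (((hole.copy (a := N + 5) (b := N + 2) (by omega)).copy (a := N + 4) (b := N + 1)
          (by omega)).copy (a := N + 3) (b := N) (by omega)))).ex (N + 5)).ex (N + 4)).ex
            (N + 3))).congr fun X v => ?_
    simp (disch := omega) [update_of_ne]
  refine h.lfp ?_ ?_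
  · rintro v (⟨h1, h2, h3⟩ | ⟨a, b, c, h1, h2, h3⟩)
    · rw [h1, h2, h3]; rfl
    · simp (disch := omega) [update_of_ne] at h3
      rw [h1, h3, h2.pair_eq]
  · intro Z hZ v hv
    generalize hn : v (N + 2) = n at hv
    induction n generalizing v with
    | zero =>
      obtain ⟨h1, h2⟩ := Prod.ext_iff.1 (congrArg Nat.unpair hv)
      exact hZ v (.inl ⟨by simpa using h1.symm, by simpa using h2.symm, hn⟩)
    | succ n ih =>
      obtain ⟨a, b, hab⟩ := exists_pairPrec (by omega : Nat.pair (v N) (v (N + 1)) ≠ 0)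
      refine hZ v (.inr ⟨a, b, n, hn, hab, ih _ ?_ ?_⟩)
      · simp
      · simp (disch := omega) only [update_of_ne, update_self]
        have := hab.pair_eq
        omega

theorem eq_pair (a b c : ℕ) : Definable fun _ v => v c = Nat.pair (v a) (v b) := by
  refine ((((eq_pair_aux (a + b + c + 1)).copy (a := c) (b := a + b + c + 1 + 2)
    (by omega)).copy (a := b) (b := a + b + c + 1 + 1) (by omega)).copy (a := a)
      (b := a + b + c + 1) (by omega)).congr fun X v => ?_
  simp (disch := omega) [update_of_ne]

/-- Eve guesses both components. `hρ` keeps the scratch registers `a` and `b` from influencing the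
rest of `ρ`. -/
theorem unpaired (x : ℕ) {ρ : ℕ → ℕ → (ℕ → ℕ) → Prop} {a b : ℕ} (hab : a ≠ b) (ha : x ≠ a)
    (hb : x ≠ b) (hρ : ∀ v m n, ρ m n (update (update v a m) b n) ↔ ρ m n v)
    (h : Definable fun _ v => ρ (v a) (v b) v) :
    Definable fun _ v => ρ (v x).unpair.1 (v x).unpair.2 v := by
  refine ((((eq_pair a b x).and h).ex b).ex a).congr fun X v => ?_
  simp only [update_self, update_of_ne hab, update_of_ne ha, update_of_ne hb, hρ]
  constructor
  · exact fun h => ⟨_, _, (Nat.pair_unpair _).symm, h⟩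
  · rintro ⟨m, n, hx, h⟩
    rwa [hx, Nat.unpair_pair]

theorem mem_pair {f : ℕ →. ℕ} (hf : ∀ x y, Definable fun _ v => v y ∈ f (v x)) (a b c : ℕ) :
    Definable fun _ v => v c ∈ f (Nat.pair (v a) (v b)) := by
  refine (((eq_pair a b (a + b + c + 1)).and (hf (a + b + c + 1) c)).ex
    (a + b + c + 1)).congr fun X v => ?_
  simp (disch := omega) [update_of_ne]

/-! ### Primitive recursion and minimisation -/

/-- The values of `f` and `g` under primitive recursion with a parameter. -/
abbrev primRec (f g : ℕ →. ℕ) (a n : ℕ) : Part ℕ :=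
  n.rec (f a) fun m IH => IH.bind fun i => g (Nat.pair a (Nat.pair m i))

/-- The recursion is unwound downwards: Eve guesses the previous value `i`, the call to `g` checks
the last step, and the recursive call has to justify `i`. Divergence is handled by leastness. -/
theorem mem_primRec {f g : ℕ →. ℕ} (hf : ∀ x y, Definable fun _ v => v y ∈ f (v x))
    (hg : ∀ x y, Definable fun _ v => v y ∈ g (v x)) (N : ℕ) :
    Definable fun _ v => v (N + 2) ∈ primRec f g (v N) (v (N + 1)) := by
  have h : Definable fun X v => (v (N + 1) = 0 ∧ v (N + 2) ∈ f (v N)) ∨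
      ∃ m i, v (N + 1) = m + 1 ∧ v (N + 2) ∈ g (Nat.pair (v N) (Nat.pair m i)) ∧
        X (update (update (update (update (update v (N + 3) m) (N + 4) i) (N + 5)
          (Nat.pair m i)) (N + 1) m) (N + 2) i) := by
    refine (((eq_zero (N + 1)).and (hf N (N + 2))).or
      ((((((eq_pair (N + 3) (N + 4) (N + 5)).and ((eq_succ (N + 3) (N + 1)).and
        ((mem_pair hg N (N + 5) (N + 2)).and
          ((hole.copy (a := N + 4) (b := N + 2) (by omega)).copy (a := N + 3) (b := N + 1)
            (by omega))))).ex (N + 5)).ex (N + 4)).ex (N + 3)))).congr fun X v => ?_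
    simp (disch := omega) [update_of_ne]
  refine h.lfp ?_ ?_
  · rintro v (⟨h1, h2⟩ | ⟨m, i, h1, h2, h3⟩)
    · rwa [h1]
    · simp (disch := omega) only [update_of_ne, update_self] at h3
      rw [h1]
      exact Part.mem_bind h3 h2
  · intro Z hZ v hv
    generalize hn : v (N + 1) = n at hv
    induction n generalizing v with
    | zero => exact hZ v (.inl ⟨hn, hv⟩)
    | succ n ih =>
      obtain ⟨i, hi, hv⟩ := Part.mem_bind_iff.1 hv
      refine hZ v (.inr ⟨n, i, hn, hv, ih _ ?_ ?_⟩)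
      · simp (disch := omega) [update_of_ne]
      · simp (disch := omega) only [update_of_ne, update_self]
        exact hi

theorem of_partrec {f : ℕ →. ℕ} (hf : Nat.Partrec f) :
    ∀ x y, Definable fun _ v => v y ∈ f (v x) := by
  induction hf with
  | zero => exact fun x y => (eq_zero y).congr fun _ v => by simp [pure, PFun.pure]
  | succ => exact fun x y => (eq_succ x y).congr fun _ v => by simp
  | left =>
    intro x y
    refine (unpaired x (a := x + y + 1) (b := x + y + 2) (ρ := fun a _ v => v y = a) (by omega)
      (by omega) (by omega) (fun v m n => ?_) (eq _ _)).congr fun _ v => by simp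
    simp (disch := omega) [update_of_ne]
  | right =>
    intro x y
    refine (unpaired x (a := x + y + 1) (b := x + y + 2) (ρ := fun _ b v => v y = b) (by omega)
      (by omega) (by omega) (fun v m n => ?_) (eq _ _)).congr fun _ v => by simp
    simp (disch := omega) [update_of_ne]
  | pair _ _ ihf ihg =>
    intro x y
    refine ((((ihf x (x + y + 1)).and ((ihg x (x + y + 2)).and
      (eq_pair (x + y + 1) (x + y + 2) y))).ex (x + y + 2)).ex (x + y + 1)).congr fun X v => ?_
    simp (disch := omega) [update_of_ne, Seq.seq, eq_comm]
  | comp _ _ ihf ihg =>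
    intro x y
    refine (((ihg x (x + y + 1)).and (ihf (x + y + 1) y)).ex (x + y + 1)).congr fun X v => ?_
    refine Part.mem_bind_iff.trans ?_
    simp (disch := omega) [update_of_ne]
  | @prec f g _ _ ihf ihg =>
    intro x y
    have h := (mem_primRec ihf ihg (x + y + 1)).copy (a := y) (b := x + y + 1 + 2) (by omega)
    refine (unpaired x (a := x + y + 1) (b := x + y + 2) (by omega) (by omega) (by omega)
      (ρ := fun a n v => v y ∈ primRec f g a n) (fun v m n => ?_) (h.congr fun X v => ?_)).congr
        fun _ v => Iff.rfl
    · simp (disch := omega) [update_of_ne]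
    · simp (disch := omega) only [update_of_ne, update_self]
  | @rfind f _ ih =>
    intro x y
    have h1 := ((eq_zero (x + y + 1)).and (mem_pair ih x y (x + y + 1))).ex (x + y + 1)
    -- Minimality without negation: for every `m`, either `y ≤ m`, or `f` has a value at `m` that
    -- exceeds a register holding `0`.
    have h2 := ((le y (x + y + 1)).or ((((eq_zero (x + y + 3)).and
      ((lt (x + y + 3) (x + y + 2)).and (mem_pair ih x (x + y + 1) (x + y + 2)))).ex
        (x + y + 3)).ex (x + y + 2))).all (x + y + 1)
    refine (h1.and h2).congr fun X v => Nat.mem_rfind.trans ?_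
    simp (disch := omega) [update_of_ne, or_iff_not_imp_left, Nat.pos_iff_ne_zero,
      and_comm]

end Definable

/-- There is a halting problem among the definable predicates. -/
theorem exists_definable_not_computablePred : ∃ P : ℕ → Prop,
    ¬ ComputablePred P ∧ Definable fun _ v => ∃ n, v 0 = n + 1 ∧ P n := by
  -- Run the program with number `n` on input `0`; its domain is a halting problem.
  let f : ℕ →. ℕ := fun n => (Nat.Partrec.Code.ofNatCode n).eval 0
  have hf : Partrec f := Nat.Partrec.Code.eval_part.comp
    (Computable.ofNat Nat.Partrec.Code) (Computable.const 0)
  refine ⟨fun n => (f n).Dom, fun h => ?_, ?_⟩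
  · obtain ⟨g, hg, hfg⟩ := ComputablePred.computable_iff.1 h
    refine ComputablePred.halting_problem 0 (ComputablePred.computable_iff.2
      ⟨fun c => g (Encodable.encode c), hg.comp Computable.encode, funext fun c => ?_⟩)
    rw [← congrFun hfg, show f (Encodable.encode c) = c.eval 0 from
      congrArg (fun c => Nat.Partrec.Code.eval c 0) (Denumerable.ofNat_encode c)]
  · refine ((((Definable.eq_succ 1 0).and
      (Definable.of_partrec (Partrec.nat_iff.1 hf) 1 2)).ex 2).ex 1).congr fun _ v => ?_
    simp [Part.dom_iff_mem, Function.update_of_ne]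

/-! ## From programs to register automata -/

namespace ProgAut

open GameInstr Function

variable {K : ℕ}

/-- The register of the automaton that holds the content of the register `a < K`. -/
def reg (K a : ℕ) : Fin (K + 1) := Fin.ofNat (K + 1) a

/-- The transitions of Adam. The Eve state `2 * q` leads to `q`, and at `2 * x + 1` Eve executes
her part of the instruction of `x`. -/
def adamStep (K : ℕ) (T : ℕ → GameInstr ℕ) (x : ℕ) (t : RegTest (Fin (K + 1))) :
    Finset (Fin (K + 1)) × ℕ :=
  match T x with
  | .all r q => ({reg K r}, 2 * q)
  | .and p q => (∅, if t 0 = .gt then 2 * p else 2 * q)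
  | .inc r _ => if t (reg K r) = .gt then ({Fin.last K}, 2 * x + 1) else (∅, 2)
  | _ => (∅, 2 * x + 1)

/-- The transitions of Eve. She wins in the state `1` and loses in the state `0`. -/
def eveStep (K : ℕ) (T : ℕ → GameInstr ℕ) (e : ℕ) (t : RegTest (Fin (K + 1))) :
    Finset (Fin (K + 1)) × ℕ :=
  if e % 2 = 0 then (∅, e / 2) else
    match T (e / 2) with
    | .hole => (∅, 1)
    | .lt a b => (∅, if t (reg K a) = .eq ∧ t (reg K b) = .lt then 1 else 0)
    | .le a b => (∅, if t (reg K a) = .eq ∧ t (reg K b) ≠ .gt then 1 else 0)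
    | .ex r q => ({reg K r}, q)
    | .or p q => (∅, if t 0 = .gt then p else q)
    | .inc r q =>
      if t (Fin.last K) = .eq then ({reg K r}, q)
      else (∅, if t (reg K r) = .gt ∧ t (Fin.last K) = .lt then 1 else 0)
    | _ => (∅, 0)

/-- One round of the game. -/
def round (T : ℕ → GameInstr ℕ) (c : ℕ × (Fin (K + 1) → ℕ)) (d o : ℕ) :
    ℕ × (Fin (K + 1) → ℕ) :=
  let m := adamStep K T c.1 (testOf c.2 d)
  let v := updateRegs c.2 d m.1
  let m' := eveStep K T m.2 (testOf v o)
  (m'.2, updateRegs v o m'.1)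

/-- The valuation of the registers of the program. -/
def ext (v : Fin (K + 1) → ℕ) (a : ℕ) : ℕ := if a < K then v (reg K a) else 0

theorem ext_of_lt (v : Fin (K + 1) → ℕ) {a : ℕ} (ha : a < K) : v (reg K a) = ext v a :=
  (if_pos ha).symm

theorem updateRegs_empty (v : Fin (K + 1) → ℕ) (d : ℕ) : updateRegs v d ∅ = v := by
  funext r
  simp [updateRegs]

theorem reg_inj {a b : ℕ} (ha : a < K) (hb : b < K) : reg K a = reg K b ↔ a = b := by
  simp [reg, Fin.ext_iff, Nat.mod_eq_of_lt (Nat.lt_succ_of_lt ha),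
    Nat.mod_eq_of_lt (Nat.lt_succ_of_lt hb)]

theorem reg_ne_last {a : ℕ} (ha : a < K) : reg K a ≠ Fin.last K := by
  simp [reg, Fin.ext_iff, Nat.mod_eq_of_lt (Nat.lt_succ_of_lt ha), ha.ne]

theorem ext_updateRegs_reg (v : Fin (K + 1) → ℕ) (d : ℕ) {r : ℕ} (hr : r < K) :
    ext (updateRegs v d {reg K r}) = update (ext v) r d := by
  funext a
  by_cases ha : a < K
  · by_cases har : a = r
    · subst har
      simp [ext, ha, updateRegs]
    · simp [ext, ha, updateRegs, reg_inj ha hr, har]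
  · have har : a ≠ r := by omega
    simp [ext, ha, har]

theorem ext_updateRegs_last (v : Fin (K + 1) → ℕ) (d : ℕ) :
    ext (updateRegs v d {Fin.last K}) = ext v := by
  funext a
  by_cases ha : a < K
  · simp [ext, ha, updateRegs, reg_ne_last ha]
  · simp [ext, ha]

/-! ### One round of the game is one step of the program -/

variable {T : ℕ → GameInstr ℕ} {Y : ℕ → (ℕ → ℕ) → Prop} {x : ℕ} {v : Fin (K + 1) → ℕ}

theorem two_mul_succ_div (x : ℕ) : (2 * x + 1) / 2 = x := by omega

theorem round_hole (h : T x = .hole) (d o : ℕ) : round T (x, v) d o = (1, v) := by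
  simp [round, adamStep, eveStep, h, two_mul_succ_div, updateRegs_empty]

/-- Tests relate registers only to the current datum. Eve must therefore output the content of `a`,
and its comparison with `b` becomes visible. -/
theorem round_lt {a b : ℕ} (h : T x = .lt a b) (ha : a < K) (hb : b < K) (d o : ℕ) :
    round T (x, v) d o = (if o = ext v a ∧ o < ext v b then 1 else 0, v) := by
  simp [round, adamStep, eveStep, h, two_mul_succ_div, updateRegs_empty, testOf, ext_of_lt, ha, hb]

theorem round_le {a b : ℕ} (h : T x = .le a b) (ha : a < K) (hb : b < K) (d o : ℕ) :
    round T (x, v) d o = (if o = ext v a ∧ o ≤ ext v b then 1 else 0, v) := by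
  simp [round, adamStep, eveStep, h, two_mul_succ_div, updateRegs_empty, testOf, ext_of_lt, ha, hb]

theorem round_ex {r q : ℕ} (h : T x = .ex r q) (d o : ℕ) :
    round T (x, v) d o = (q, updateRegs v o {reg K r}) := by
  simp [round, adamStep, eveStep, h, two_mul_succ_div, updateRegs_empty]

theorem round_all {r q : ℕ} (h : T x = .all r q) (d o : ℕ) :
    round T (x, v) d o = (q, updateRegs v d {reg K r}) := by
  simp [round, adamStep, eveStep, h, updateRegs_empty]

theorem round_and {p q : ℕ} (h : T x = .and p q) (d o : ℕ) :
    round T (x, v) d o = (if v 0 < d then p else q, v) := by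
  by_cases hd : v 0 < d <;> simp [round, adamStep, eveStep, h, updateRegs_empty, testOf, hd]

theorem round_or {p q : ℕ} (h : T x = .or p q) (d o : ℕ) :
    round T (x, v) d o = (if v 0 < o then p else q, v) := by
  simp [round, adamStep, eveStep, h, two_mul_succ_div, updateRegs_empty, testOf]

/-- A proposal that does not exceed the register is illegal: the Eve state `2` leads to her winning
state `1`. -/
theorem round_inc_of_le {r q : ℕ} (h : T x = .inc r q) (hr : r < K) {d : ℕ} (hd : d ≤ ext v r)
    (o : ℕ) : round T (x, v) d o = (1, v) := by
  simp [round, adamStep, eveStep, h, updateRegs_empty, testOf, ext_of_lt, hr, hd.not_gt]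

/-- The proposal is kept in the extra register `Fin.last K`, so that Eve's answer can be tested for
equality with it or for lying strictly below it. -/
theorem round_inc_of_lt {r q : ℕ} (h : T x = .inc r q) (hr : r < K) {d : ℕ} (hd : ext v r < d)
    (o : ℕ) : round T (x, v) d o =
      if o = d then (q, updateRegs (updateRegs v d {Fin.last K}) o {reg K r})
      else (if ext v r < o ∧ o < d then 1 else 0, updateRegs v d {Fin.last K}) := by
  have h1 : updateRegs v d {Fin.last K} (Fin.last K) = d := by simp [updateRegs]
  have h2 : updateRegs v d {Fin.last K} (reg K r) = ext v r := by
    rw [ext_of_lt (updateRegs v d {Fin.last K}) hr, ext_updateRegs_last]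
  by_cases ho : o = d
  · simp [round, adamStep, eveStep, h, two_mul_succ_div, testOf, ext_of_lt v hr, hd, ho, h1]
  · simp [round, adamStep, eveStep, h, two_mul_succ_div, testOf, ext_of_lt v hr, hd, ho, h1, h2,
      updateRegs_empty]

/-- Only Adam's critical moves are used; state `0` is lost, so Eve cannot have failed a test. -/
theorem sem_of_round (hb : (T x).bound ≤ K) (h0 : ∀ v, ¬ Y 0 v)
    (h : ∀ d, ∃ o, Y (round T (x, v) d o).1 (ext (round T (x, v) d o).2)) :
    (T x).Sem (fun _ => True) Y (ext v) := by
  cases hI : T x with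
  | hole => trivial
  | lt a b =>
    simp only [hI, bound] at hb
    obtain ⟨o, ho⟩ := h 0
    rw [round_lt hI (by omega) (by omega)] at ho
    split_ifs at ho with hc
    · exact hc.1.symm.trans_lt hc.2
    · exact absurd ho (h0 _)
  | le a b =>
    simp only [hI, bound] at hb
    obtain ⟨o, ho⟩ := h 0
    rw [round_le hI (by omega) (by omega)] at ho
    split_ifs at ho with hc
    · exact hc.1.symm.trans_le hc.2
    · exact absurd ho (h0 _)
  | ex r q =>
    simp only [hI, bound] at hb
    obtain ⟨o, ho⟩ := h 0
    rw [round_ex hI, ext_updateRegs_reg _ _ (by omega)] at ho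
    exact ⟨o, ho⟩
  | all r q =>
    simp only [hI, bound] at hb
    intro d
    obtain ⟨o, ho⟩ := h d
    rwa [round_all hI, ext_updateRegs_reg _ _ (by omega)] at ho
  | and p q =>
    -- The moves `0` and `v 0 + 1` lie on different sides of the threshold `v 0`, so both branches
    -- are open to Adam.
    obtain ⟨o, ho⟩ := h 0
    obtain ⟨o', ho'⟩ := h (v 0 + 1)
    rw [round_and hI] at ho ho'
    simp only [not_lt_zero, if_false] at ho
    simp only [Nat.lt_succ_self, if_true] at ho'
    exact ⟨ho', ho⟩
  | or p q =>
    obtain ⟨o, ho⟩ := h 0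
    rw [round_or hI] at ho
    split_ifs at ho
    exacts [.inl ho, .inr ho]
  | inc r q =>
    simp only [hI, bound] at hb
    -- No number lies strictly between a content and its successor, so Eve has to repeat this
    -- proposal.
    obtain ⟨o, ho⟩ := h (ext v r + 1)
    rw [round_inc_of_lt hI (by omega) (Nat.lt_succ_self _)] at ho
    split_ifs at ho with hc hc'
    · rwa [ext_updateRegs_reg _ _ (by omega), ext_updateRegs_last, hc] at ho
    · omega
    · exact absurd ho (h0 _)

theorem round_of_sem (hb : (T x).bound ≤ K) (h1 : ∀ v, Y 1 v)
    (h : (T x).Sem (fun _ => True) Y (ext v)) (d : ℕ) :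
    ∃ o, Y (round T (x, v) d o).1 (ext (round T (x, v) d o).2) := by
  cases hI : T x with
  | hole => exact ⟨0, by simpa only [round_hole hI] using h1 _⟩
  | lt a b =>
    simp only [hI, bound] at hb h
    refine ⟨ext v a, ?_⟩
    rw [round_lt hI (by omega) (by omega), if_pos ⟨rfl, h⟩]
    exact h1 _
  | le a b =>
    simp only [hI, bound] at hb h
    refine ⟨ext v a, ?_⟩
    rw [round_le hI (by omega) (by omega), if_pos ⟨rfl, h⟩]
    exact h1 _
  | ex r q =>
    simp only [hI, bound] at hb h
    obtain ⟨o, ho⟩ := h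
    refine ⟨o, ?_⟩
    rwa [round_ex hI, ext_updateRegs_reg _ _ (by omega)]
  | all r q =>
    simp only [hI, bound] at hb h
    refine ⟨0, ?_⟩
    rw [round_all hI, ext_updateRegs_reg _ _ (by omega)]
    exact h d
  | and p q =>
    simp only [hI] at h
    refine ⟨0, ?_⟩
    rw [round_and hI]
    split_ifs
    exacts [h.1, h.2]
  | or p q =>
    simp only [hI] at h
    rcases h with h | h
    · refine ⟨v 0 + 1, ?_⟩
      rwa [round_or hI, if_pos (Nat.lt_succ_self _)]
    · refine ⟨0, ?_⟩
      rwa [round_or hI, if_neg (Nat.not_lt_zero _)]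
  | inc r q =>
    simp only [hI, bound] at hb h
    rcases le_or_gt d (ext v r) with hd | hd
    · exact ⟨0, by simpa only [round_inc_of_le hI (by omega) hd] using h1 _⟩
    · refine ⟨ext v r + 1, ?_⟩
      rw [round_inc_of_lt hI (by omega) hd]
      split_ifs with hc hc'
      · rwa [ext_updateRegs_reg _ _ (by omega), ext_updateRegs_last]
      · exact h1 _
      · omega

/-! ### The automaton of a program and its acceptance condition -/

/-- The successors of an instruction are smaller than `N`. -/
def Below (N : ℕ) : GameInstr ℕ → Prop
  | .ex _ q => q < N
  | .all _ q => q < N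
  | .and p q => p < N ∧ q < N
  | .or p q => p < N ∧ q < N
  | .inc _ q => q < N
  | _ => True

theorem adamStep_lt {N : ℕ} (hN : 2 ≤ N) (hT : ∀ x < N, Below N (T x)) {x : ℕ} (hx : x < N)
    (t : RegTest (Fin (K + 1))) : (adamStep K T x t).2 < 2 * N := by
  have h := hT x hx
  unfold adamStep
  cases hI : T x <;> simp only [hI, Below] at h ⊢ <;> (try split_ifs) <;>
    (try dsimp only) <;> omega

theorem eveStep_lt {N : ℕ} (hN : 2 ≤ N) (hT : ∀ x < N, Below N (T x)) {e : ℕ} (he : e < 2 * N)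
    (t : RegTest (Fin (K + 1))) : (eveStep K T e t).2 < N := by
  have h := hT (e / 2) (by omega)
  unfold eveStep
  by_cases h2 : e % 2 = 0
  · rw [if_pos h2]
    dsimp only
    omega
  · rw [if_neg h2]
    cases hI : T (e / 2) <;> simp only [hI, Below] at h ⊢ <;> (try split_ifs) <;>
      (try dsimp only) <;> omega

/-- The automaton of the program `T`, restricted to the states below `N`, with the initial
state `x₀`. -/
def progAut (K : ℕ) (T : ℕ → GameInstr ℕ) {N : ℕ} (hN : 2 ≤ N) (hT : ∀ x < N, Below N (T x))
    (x₀ : Fin N) : DetRegAut (Fin N) (Fin (2 * N)) (Fin (K + 1)) where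
  q0 := x₀
  deltaA x t := ((adamStep K T x t).1, ⟨(adamStep K T x t).2, adamStep_lt hN hT x.2 t⟩)
  deltaE e t := ((eveStep K T e t).1, ⟨(eveStep K T e t).2, eveStep_lt hN hT e.2 t⟩)
  index := 2
  prio := Sum.elim (fun x => if (x : ℕ) = 1 then 2 else 1) fun _ => 1
  prio_mem := by
    rintro (x | e)
    · simp only [Sum.elim_inl]
      split_ifs <;> omega
    · simp

/-- The configurations between the rounds. -/
def position (T : ℕ → GameInstr ℕ) (c : ℕ × (Fin (K + 1) → ℕ)) (w : ℕ → ℕ × ℕ) :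
    ℕ → ℕ × (Fin (K + 1) → ℕ)
  | 0 => c
  | j + 1 => round T (position T c w j) (w j).1 (w j).2

section

variable {N : ℕ} (hN : 2 ≤ N) (hT : ∀ x < N, Below N (T x)) (x₀ : Fin N) (w : ℕ → ℕ × ℕ)

theorem run_even (j : ℕ) :
    ∃ h : (position T ((x₀ : ℕ), fun _ : Fin (K + 1) => 0) w j).1 < N,
      (progAut K T hN hT x₀).run (interleave w) (2 * j) =
        (.inl ⟨_, h⟩, (position T ((x₀ : ℕ), fun _ => 0) w j).2) := by
  induction j with
  | zero => exact ⟨x₀.2, rfl⟩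
  | succ j ih =>
    obtain ⟨h, ih⟩ := ih
    have h1 : interleave w (2 * j) = (w j).1 := by simp [interleave]
    have h2 : interleave w (2 * j + 1) = (w j).2 := by
      simp [interleave, two_mul_succ_div]
    have h3 : (progAut K T hN hT x₀).run (interleave w) (2 * (j + 1)) =
        (progAut K T hN hT x₀).step ((progAut K T hN hT x₀).step
          ((progAut K T hN hT x₀).run (interleave w) (2 * j)) (interleave w (2 * j)))
            (interleave w (2 * j + 1)) := rfl
    rw [h3, h1, h2, ih]
    exact ⟨_, rfl⟩

theorem run_odd (j : ℕ) :
    ∃ e, ((progAut K T hN hT x₀).run (interleave w) (2 * j + 1)).1 = .inr e := by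
  obtain ⟨h, ih⟩ := run_even hN hT x₀ w j
  have h3 : (progAut K T hN hT x₀).run (interleave w) (2 * j + 1) =
      (progAut K T hN hT x₀).step
        ((progAut K T hN hT x₀).run (interleave w) (2 * j)) (interleave w (2 * j)) := rfl
  rw [h3, ih]
  exact ⟨_, rfl⟩

theorem prio_even (j : ℕ) :
    (progAut K T hN hT x₀).prio ((progAut K T hN hT x₀).run (interleave w) (2 * j)).1 =
      if (position T ((x₀ : ℕ), fun _ : Fin (K + 1) => 0) w j).1 = 1 then 2 else 1 := by
  obtain ⟨h, ih⟩ := run_even hN hT x₀ w j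
  rw [ih]
  rfl

theorem prio_odd (j : ℕ) :
    (progAut K T hN hT x₀).prio ((progAut K T hN hT x₀).run (interleave w) (2 * j + 1)).1 = 1 := by
  obtain ⟨e, h⟩ := run_odd hN hT x₀ w j
  rw [h]
  rfl

/-- Only the Adam state `1` has priority `2`, and it recurs in every later round since a `hole`
leads back to it. Reaching it once is thus the same as visiting it infinitely often. -/
theorem accepts_iff (hT1 : T 1 = .hole) :
    (progAut K T hN hT x₀).Accepts (interleave w) ↔
      ∃ j, (position T ((x₀ : ℕ), fun _ : Fin (K + 1) => 0) w j).1 = 1 := by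
  constructor
  · rintro ⟨p, ⟨hp, -⟩, hev⟩
    obtain ⟨n, hn⟩ := hp.exists
    by_contra! h
    obtain ⟨j, rfl | rfl⟩ := n.even_or_odd'
    · rw [prio_even, if_neg (h j)] at hn
      subst hn
      exact Nat.not_even_one hev
    · rw [prio_odd] at hn
      subst hn
      exact Nat.not_even_one hev
  · rintro ⟨j, hj⟩
    have hall : ∀ i, j ≤ i → (position T ((x₀ : ℕ), fun _ : Fin (K + 1) => 0) w i).1 = 1 := by
      intro i hi
      induction i, hi using Nat.le_induction with
      | base => exact hj
      | succ i _ ih =>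
        rw [position, ← Prod.mk.eta (p := position _ _ _ i), ih, round_hole hT1]
    refine ⟨2, ⟨?_, ?_⟩, even_two⟩
    · refine Filter.frequently_atTop.2 fun n => ⟨2 * (n + j), by omega, ?_⟩
      rw [prio_even, if_pos (hall _ (by omega))]
    · rintro p hp
      obtain ⟨n, hn⟩ := Filter.Frequently.exists hp
      exact hn ▸ ((progAut K T hN hT x₀).prio_mem _).2

end

end ProgAut

/-! ### Winning regions and strategies -/

namespace ProgAut

open GameInstr Function

section

variable {K : ℕ} {T : ℕ → GameInstr ℕ}

theorem position_succ (c : ℕ × (Fin (K + 1) → ℕ)) (w : ℕ → ℕ × ℕ) (j : ℕ) :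
    position T c w (j + 1) =
      position T (round T c (w 0).1 (w 0).2) (fun i => w (i + 1)) j := by
  induction j with
  | zero => rfl
  | succ j ih => rw [position, ih]; rfl

/-- Induction along the least fixed point: Eve's first answer leads to positions that already carry
strategies, one for each first move of Adam, and these are glued together. -/
theorem exists_strategy (hK : ∀ x, (T x).bound ≤ K) {x : ℕ} {u : ℕ → ℕ}
    (h : Wins T (fun _ => True) x u) (v : Fin (K + 1) → ℕ) (hv : ext v = u) :
    ∃ σ : List ℕ → ℕ, ∀ w : ℕ → ℕ × ℕ,
      (∀ j, (w j).2 = σ ((List.range (j + 1)).map fun i => (w i).1)) →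
        ∃ j, (position T (x, v) w j).1 = 1 := by
  refine h.induction (Y := fun x u => ∀ v : Fin (K + 1) → ℕ, ext v = u →
    ∃ σ : List ℕ → ℕ, ∀ w : ℕ → ℕ × ℕ,
      (∀ j, (w j).2 = σ ((List.range (j + 1)).map fun i => (w i).1)) →
        ∃ j, (position T (x, v) w j).1 = 1) ?_ v hv
  rintro x _ h v rfl
  -- In state `1` the goal is already reached in round `0`, so any strategy will do.
  have := fun d => round_of_sem (hK x) (fun _ _ _ => ⟨fun _ => 0, fun _ _ => ⟨0, rfl⟩⟩) h d
  choose o ho using this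
  choose σ hσ using fun d => ho d _ rfl
  -- A history of length one gets the first answer; a longer one is passed, without its first input,
  -- to the strategy chosen for that input.
  refine ⟨fun is => if is.tail = [] then o is.headI else σ is.headI is.tail, fun w hw => ?_⟩
  have h0 : (w 0).2 = o (w 0).1 := by simpa using hw 0
  obtain ⟨j, hj⟩ := hσ (w 0).1 (fun i => w (i + 1)) fun j => by
    have := hw (j + 1)
    rw [List.range_succ_eq_map] at this
    simpa [Function.comp_def] using this
  refine ⟨j + 1, ?_⟩
  rw [position_succ, h0]
  exact hj

theorem eveWins_iff (hK : ∀ x, (T x).bound ≤ K) (hT0 : T 0 = .lt 0 0) (hT1 : T 1 = .hole) {N : ℕ}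
    (hN : 2 ≤ N) (hT : ∀ x < N, Below N (T x)) (x₀ : Fin N) :
    ((progAut K T hN hT x₀).churchGame ℕ).EveWins ↔
      Wins T (fun _ => True) (x₀ : ℕ) fun _ => 0 := by
  have hext : ext (fun _ : Fin (K + 1) => 0) = fun _ => 0 := by
    funext a
    simp [ext]
  have hspec : ∀ w : ℕ → ℕ × ℕ, w ∈ ((progAut K T hN hT x₀).churchGame ℕ).spec ↔
      ∃ j, (position T ((x₀ : ℕ), fun _ : Fin (K + 1) => 0) w j).1 = 1 :=
    fun w => accepts_iff hN hT x₀ w hT1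
  constructor
  · rintro ⟨lamE, hE⟩
    by_contra hW
    -- Outside the winning region Adam has a move after which every answer stays outside.
    have key : ∀ c : ℕ × (Fin (K + 1) → ℕ), ∃ d, ¬ Wins T (fun _ => True) c.1 (ext c.2) →
        ∀ o, ¬ Wins T (fun _ => True) (round T c d o).1 (ext (round T c d o).2) := by
      intro c
      by_contra! h
      refine (h 0).1 (wins_of_sem (sem_of_round (hK _) (fun v hv => ?_) fun d => (h d).2))
      rw [wins_iff, hT0] at hv
      exact lt_irrefl _ hv
    choose d hd using key
    -- Adam's own moves are determined by the position, so Eve's outputs alone let him reconstruct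
    -- the configuration.
    let pos (os : List ℕ) : ℕ × (Fin (K + 1) → ℕ) :=
      os.foldl (fun c o => round T c (d c) o) ((x₀ : ℕ), fun _ => 0)
    let lamA : ChurchGame.AdamStrategy ℕ ℕ := fun os => d (pos os)
    have hpos : ∀ j, position T ((x₀ : ℕ), fun _ : Fin (K + 1) => 0)
        (ChurchGame.outcome lamA lamE) j = pos (ChurchGame.history lamA lamE j).2 := by
      intro j
      induction j with
      | zero => rfl
      | succ j ih =>
        rw [position, ih]
        simp [ChurchGame.history, ChurchGame.outcome, pos, lamA]
    have hlose : ∀ os, ¬ Wins T (fun _ => True) (pos os).1 (ext (pos os).2) := by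
      intro os
      induction os using List.reverseRecOn with
      | nil => simpa only [pos, List.foldl_nil, hext] using hW
      | append_singleton os o ih =>
        simp only [pos, List.foldl_append, List.foldl_cons, List.foldl_nil]
        exact hd _ ih o
    obtain ⟨j, hj⟩ := (hspec _).1 (hE lamA)
    refine hlose (ChurchGame.history lamA lamE j).2 (wins_of_sem ?_)
    rw [← hpos, hj, hT1]
    trivial
  · intro h
    obtain ⟨σ, hσ⟩ := exists_strategy hK h _ hext
    exact ⟨σ, fun lamA => (hspec _).2 (hσ _ fun j => (ChurchGame.outcome_spec lamA σ j).2)⟩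

end

/-! ### Loading the input -/

variable {m : ℕ}

/-- The program `T` with the initial state `q₀`, preceded by a chain of increments of the
register `0`. -/
def chain (T : Fin m → GameInstr (Fin m)) (q₀ : Fin m) : ℕ → GameInstr ℕ
  | 0 => .lt 0 0
  | 1 => .hole
  | x + 2 =>
    if h : x < m then (T ⟨x, h⟩).map fun q : Fin m => (q : ℕ) + 2
    else if x = m then .or ((q₀ : ℕ) + 2) ((q₀ : ℕ) + 2)
    else .inc 0 (x + 1)

variable (T : Fin m → GameInstr (Fin m)) (q₀ : Fin m)

theorem chain_of_le {x : ℕ} (hx : m + 3 ≤ x) : chain T q₀ x = .inc 0 (x - 1) := by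
  obtain ⟨y, rfl⟩ := Nat.exists_eq_add_of_le' (show 2 ≤ x by omega)
  rw [chain, dif_neg (by omega), if_neg (by omega)]
  rfl

theorem chain_mid : chain T q₀ (m + 2) = .or ((q₀ : ℕ) + 2) ((q₀ : ℕ) + 2) := by
  rw [chain, dif_neg (lt_irrefl m), if_pos rfl]

theorem bound_chain {K : ℕ} (hK : ∀ q, (T q).bound ≤ K) (x : ℕ) :
    (chain T q₀ x).bound ≤ K + 1 := by
  match x with
  | 0 => simp [chain, bound]
  | 1 => simp [chain, bound]
  | x + 2 =>
    rw [chain]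
    split_ifs
    · rw [bound_map]
      exact (hK _).trans (Nat.le_succ _)
    · simp [bound]
    · simp [bound]

theorem below_chain {N : ℕ} (hN : m + 3 ≤ N) (x : ℕ) (hx : x < N) : Below N (chain T q₀ x) := by
  match x with
  | 0 => trivial
  | 1 => trivial
  | x + 2 =>
    rw [chain]
    split_ifs
    · cases T _ <;> simp only [GameInstr.map, Below] <;> omega
    · simp only [Below]
      omega
    · simp only [Below]
      omega

/-- State `m + 2 + n` has `n` increments ahead of it; `m + 2` itself is a jump to `q₀`, written as a
trivial choice. -/
theorem wins_chain (X : (ℕ → ℕ) → Prop) (n : ℕ) (v : ℕ → ℕ) :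
    Wins (chain T q₀) X (m + 2 + n) v ↔ Wins T X q₀ (update v 0 (v 0 + n)) := by
  induction n generalizing v with
  | zero =>
    rw [wins_iff, add_zero, chain_mid]
    have := wins_embed (T := T) (T' := chain T q₀) (e := fun q : Fin m => (q : ℕ) + 2)
      (fun q => by rw [chain, dif_pos q.2]) X q₀ v
    simpa [Sem] using this
  | succ n ih =>
    rw [wins_iff, chain_of_le T q₀ (by omega)]
    simp only [Sem]
    rw [show m + 2 + (n + 1) - 1 = m + 2 + n by omega, ih]
    simp [add_assoc, add_comm 1 n]

/-- The automaton that plays the program `T` on the input `n + 1`. -/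
def inputAut (K : ℕ) (n : ℕ) : FinRegAut where
  numA := m + 4 + n
  numE := 2 * (m + 4 + n)
  numR := K + 1
  aut := progAut K (chain T q₀) (by omega) (below_chain T q₀ (by omega)) ⟨m + 3 + n, by omega⟩

theorem eveWins_inputAut {K : ℕ} (hK : ∀ q, (T q).bound ≤ K) (n : ℕ) :
    ((inputAut T q₀ (K + 1) n).aut.churchGame ℕ).EveWins ↔
      Wins T (fun _ => True) q₀ (update (fun _ => 0) 0 (n + 1)) := by
  refine (eveWins_iff (bound_chain T q₀ hK) rfl rfl (by omega) (below_chain T q₀ (by omega))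
    _).trans ?_
  rw [Fin.val_mk, show m + 3 + n = m + 2 + (n + 1) by omega, wins_chain, zero_add]

/-! ### Computing the tables -/

/-- The finitely many exceptional values are looked up in a constant list. -/
theorem _root_.Primrec.of_eq_of_ge {β : Type*} [Primcodable β] {f g : ℕ → β} (hg : Primrec g)
    (c : ℕ) (h : ∀ x, c ≤ x → f x = g x) : Primrec f := by
  refine (Primrec.option_getD.comp (Primrec.list_getElem?.comp
    (Primrec.const ((List.range c).map f)) Primrec.id) hg).of_eq fun x => ?_
  rcases lt_or_ge x c with hx | hx
  · simp [hx]
  · simp [hx, h x hx]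

theorem _root_.Primrec.list_ofFn_length {β : Type*} [Primcodable β] {f : ℕ → β} (hf : Primrec f)
    {N : ℕ → ℕ} (hN : Primrec N) : Primrec fun n => List.ofFn fun i : Fin (N n) => f i := by
  refine (Primrec.list_map (Primrec.list_range.comp hN) (hf.comp Primrec.snd).to₂).of_eq
    fun n => ?_
  rw [List.ofFn_eq_map, ← List.map_coe_finRange_eq_range, List.map_map]
  rfl

/-- From `m + 3` on, all states are increments of the register `0`, so the transitions have a
uniform formula; the test is fixed, hence its conditions are constants. -/
theorem primrec_adamStep (K : ℕ) (t : RegTest (Fin (K + 1))) :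
    Primrec fun x => (List.ofFn fun r => decide (r ∈ (adamStep K (chain T q₀) x t).1),
      (adamStep K (chain T q₀) x t).2) := by
  refine Primrec.of_eq_of_ge (g := fun x => if t (reg K 0) = .gt then
    (List.ofFn fun r => decide (r ∈ ({Fin.last K} : Finset (Fin (K + 1)))), 2 * x + 1)
    else (List.ofFn fun r => decide (r ∈ (∅ : Finset (Fin (K + 1)))), 2)) ?_ (m + 3) ?_
  · split_ifs
    · exact (Primrec.const _).pair (Primrec.succ.comp
        (Primrec.nat_mul.comp (Primrec.const 2) Primrec.id))
    · exact Primrec.const _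
  · intro x hx
    simp only [adamStep, chain_of_le T q₀ hx]
    split_ifs <;> rfl

theorem primrec_eveStep (K : ℕ) (t : RegTest (Fin (K + 1))) :
    Primrec fun e => (List.ofFn fun r => decide (r ∈ (eveStep K (chain T q₀) e t).1),
      (eveStep K (chain T q₀) e t).2) := by
  refine Primrec.of_eq_of_ge (g := fun e => if e % 2 = 0 then
    (List.ofFn fun r => decide (r ∈ (∅ : Finset (Fin (K + 1)))), e / 2)
    else if t (Fin.last K) = .eq then
      (List.ofFn fun r => decide (r ∈ ({reg K 0} : Finset (Fin (K + 1)))), e / 2 - 1)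
    else (List.ofFn fun r => decide (r ∈ (∅ : Finset (Fin (K + 1)))),
      if t (reg K 0) = .gt ∧ t (Fin.last K) = .lt then 1 else 0)) ?_ (2 * (m + 3)) ?_
  · have h2 : Primrec fun e : ℕ => e / 2 := Primrec.nat_div.comp Primrec.id (Primrec.const 2)
    refine Primrec.ite (Primrec.eq.comp (Primrec.nat_mod.comp Primrec.id (Primrec.const 2))
      (Primrec.const 0)) ((Primrec.const _).pair h2) ?_
    split_ifs
    · exact (Primrec.const _).pair (Primrec.pred.comp h2)
    · exact Primrec.const _
    · exact Primrec.const _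
  · intro e he
    simp only [eveStep, chain_of_le T q₀ (show m + 3 ≤ e / 2 by omega)]
    split_ifs <;> rfl

/-- The number of registers, and so the list of tests, does not depend on `n`. The tables are
initial segments of fixed sequences of rows, cut at a length that depends on `n`. -/
theorem primrec_encode_inputAut (K : ℕ) : Primrec fun n => (inputAut T q₀ K n).encode := by
  have hA : Primrec fun n : ℕ => m + 4 + n := Primrec.nat_add.comp (Primrec.const _) Primrec.id
  have hE : Primrec fun n : ℕ => 2 * (m + 4 + n) := Primrec.nat_mul.comp (Primrec.const _) hA
  have hI : Primrec fun n : ℕ => m + 3 + n := Primrec.nat_add.comp (Primrec.const _) Primrec.id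
  have h1 := Primrec.list_ofFn_length (Primrec.list_ofFn fun i =>
    primrec_adamStep T q₀ K (testOfIndex (K + 1) i)) hA
  have h2 := Primrec.list_ofFn_length (Primrec.list_ofFn fun i =>
    primrec_eveStep T q₀ K (testOfIndex (K + 1) i)) hE
  have h3 : Primrec fun x : ℕ => if x = 1 then 2 else 1 :=
    Primrec.ite (Primrec.eq.comp Primrec.id (Primrec.const 1)) (Primrec.const 2) (Primrec.const 1)
  exact (hA.pair (hE.pair ((Primrec.const (K + 1)).pair (hI.pair (Primrec.const 2))))).pair
    ((h1.pair h2).pair ((Primrec.list_ofFn_length h3 hA).pair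
      (Primrec.list_ofFn_length (Primrec.const 1) hE)))

end ProgAut

/-- No algorithm decides, given (the code of) a deterministic register automaton, whether Eve wins
the Church game over `(ℕ, ≤)` that it specifies. -/
theorem mainTheorem4 :
    ¬ ∃ f : RegAutCode → Bool, Computable f ∧
      ∀ S : FinRegAut, f S.encode = true ↔ (S.aut.churchGame ℕ).EveWins := by
  rintro ⟨f, hf, hfS⟩
  obtain ⟨P, hP, Q, _, T, q, hT⟩ := exists_definable_not_computablePred
  obtain ⟨m, ⟨e⟩⟩ := Finite.exists_equiv_fin Q
  obtain ⟨K, hK⟩ := (Set.finite_range fun q => (T q).bound).bddAbove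
  let U : Fin m → GameInstr (Fin m) := fun i => (T (e.symm i)).map e
  have hU : ∀ i, (U i).bound ≤ K := fun i => by
    rw [GameInstr.bound_map]
    exact hK ⟨_, rfl⟩
  -- Composing the supposed algorithm with the table generator decides `P`. The bound `K + 1` makes
  -- room for the register `0`, which the loading chain uses even if the program does not.
  refine hP (ComputablePred.computable_iff.2
    ⟨fun n => f (ProgAut.inputAut U (e q) (K + 1) n).encode,
      hf.comp (ProgAut.primrec_encode_inputAut U (e q) (K + 1)).to_comp, funext fun n => ?_⟩)
  rw [hfS, ProgAut.eveWins_inputAut U (e q) hU,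
    GameInstr.wins_embed (T := T) (e := e) (fun q => by simp [U]), hT]
  simp
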